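/- Let $\alpha$ be a real number satisfying the following condition: there are constants $C$ and $N$ such that, for every $n \ge N$, every finite distributive lattice $D$ with exactly $n$ join-irreducible elements is isomorphic to the congruence lattice of some finite lattice $L$ with at most $C n^{\alpha}$ elements (that is, every finite distributive lattice with $n$ join-irreducible elements can be represented as the congruence lattice of a lattice with $O(n^{\alpha})$ elements). Then $\alpha \ge 2$. -/

import Mathlib

/-- Lattice congruences ordered by inclusion: `c ≤ d` iff every pair identified by `c` is
identified by `d`. With this order `LatticeCon L` is the congruence lattice of `L`. -/
instance LatticeCon.instPartialOrderInclusion {L : Type*} [Lattice L] :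
    PartialOrder (LatticeCon L) where
  le c d := ∀ ⦃x y : L⦄, c.r x y → d.r x y
  le_refl _ _ _ h := h
  le_trans _ _ _ h₁ h₂ _ _ h := h₂ (h₁ h)
  le_antisymm c d h₁ h₂ := by
    have h : c.toSetoid = d.toSetoid := le_antisymm h₁ h₂
    cases c
    cases d
    cases h
    rfl

/-- The number of join-irreducible elements of a finite lattice (the least element is not
join-irreducible). -/
noncomputable def numJoinIrred (D : Type*) [Lattice D] : ℕ :=
  Nat.card {a : D // SupIrred a}

/-- Every finite distributive lattice with `n` join-irreducible elements is, up to isomorphism, the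
congruence lattice of a finite lattice with `O(n ^ α)` elements as `n → ∞`; the constants of the
`O` depend on `α` only. An order isomorphism between lattices is the same as a lattice isomorphism.
Finite lattices in `Type` represent all finite lattices. -/
def RepresentableWithSize (α : ℝ) : Prop :=
  ∃ (C : ℝ) (N : ℕ), ∀ (D : Type) [DistribLattice D] [Finite D], N ≤ numJoinIrred D →
    ∃ (L : Type) (_ : Lattice L) (_ : Finite L),
      Nonempty (D ≃o LatticeCon L) ∧ (Nat.card L : ℝ) ≤ C * (numJoinIrred D : ℝ) ^ α

/-! Test lattice: the lower sets of the order on n + n elements in which every lower element lies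
below every upper one. Through an isomorphism with the congruences of `L`, each interval of `L` gets
a color in `D`. Each of the n² pairs (upper `a`, lower `b`) is a cover among join-primes, so
`exists_common_endpoint` yields a point of `L` at which intervals of colors `a` and `b` both start
or both end. Joining k intervals with incomparable join-prime colors and a common bottom gives 2^k
distinct elements, so one point serves at most (log₂ |L|)² pairs in each direction. Thus n² ≤ 2 |L|
(log₂ |L|)², which rules out |L| = O(n^α) with α < 2. -/

namespace LatticeCon

/-! ### Lattice congruences and their joins. -/

variable {L D : Type*} [Lattice L]

/-- A congruence identifying the endpoints of an interval identifies any two comparable elements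
of that interval. -/
lemma rel_of_mem_interval (c : LatticeCon L) {x y u v : L} (h : c.r x y) (hxu : x ≤ u)
    (huv : u ≤ v) (hvy : v ≤ y) : c.r u v := by
  have := c.inf (c.sup h (c.refl u)) (c.refl v)
  rwa [sup_eq_right.2 hxu, sup_eq_left.2 (huv.trans hvy), inf_eq_left.2 huv,
    inf_eq_right.2 hvy] at this

/-- The congruence generated by a pair. -/
def principal (x y : L) : LatticeCon L where
  r u v := ∀ c : LatticeCon L, c.r x y → c.r u v
  iseqv := ⟨fun u c _ => c.refl u, fun h c hc => c.symm (h c hc),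
    fun h₁ h₂ c hc => c.trans (h₁ c hc) (h₂ c hc)⟩
  inf h₁ h₂ c hc := c.inf (h₁ c hc) (h₂ c hc)
  sup h₁ h₂ c hc := c.sup (h₁ c hc) (h₂ c hc)

lemma principal_le_iff {x y : L} {c : LatticeCon L} : principal x y ≤ c ↔ c.r x y :=
  ⟨fun h => h fun _ hd => hd, fun h _ _ huv => huv c h⟩

/-- The congruence whose relation is the equivalence closure of the union of two congruences. -/
def join (c d : LatticeCon L) : LatticeCon L :=
  have left {f : L → L} (hc : ∀ x y, c.r x y → c.r (f x) (f y))
      (hd : ∀ x y, d.r x y → d.r (f x) (f y)) {x y : L}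
      (h : Relation.EqvGen (fun x y => c.r x y ∨ d.r x y) x y) :
      Relation.EqvGen (fun x y => c.r x y ∨ d.r x y) (f x) (f y) := by
    induction h with
    | rel x y h => exact .rel _ _ (h.imp (hc x y) (hd x y))
    | refl x => exact .refl _
    | symm x y _ ih => exact .symm _ _ ih
    | trans x y z _ _ ih₁ ih₂ => exact .trans _ _ _ ih₁ ih₂
  { r := Relation.EqvGen fun x y => c.r x y ∨ d.r x y
    iseqv := Relation.EqvGen.is_equivalence _
    inf := fun {w x y z} h₁ h₂ =>
      .trans _ (x ⊓ y) _
        (left (f := (· ⊓ y)) (fun _ _ h => c.inf h (c.refl y)) (fun _ _ h => d.inf h (d.refl y)) h₁)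
        (left (f := (x ⊓ ·)) (fun _ _ h => c.inf (c.refl x) h) (fun _ _ h => d.inf (d.refl x) h) h₂)
    sup := fun {w x y z} h₁ h₂ =>
      .trans _ (x ⊔ y) _
        (left (f := (· ⊔ y)) (fun _ _ h => c.sup h (c.refl y)) (fun _ _ h => d.sup h (d.refl y)) h₁)
        (left (f := (x ⊔ ·)) (fun _ _ h => c.sup (c.refl x) h) (fun _ _ h => d.sup (d.refl x) h) h₂)}

lemma le_join_left (c d : LatticeCon L) : c ≤ join c d := fun _ _ h => .rel _ _ (.inl h)

lemma le_join_right (c d : LatticeCon L) : d ≤ join c d := fun _ _ h => .rel _ _ (.inr h)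

/-- A covering pair identified by a join of two congruences is identified by one of them. -/
lemma rel_or_rel_of_join {c d : LatticeCon L} {u v : L} (huv : u ⋖ v) (h : (join c d).r u v) :
    c.r u v ∨ d.r u v := by
  by_contra! hn
  -- The map t ↦ (t ⊔ u) ⊓ v takes only the values u and v, so it is constant on the classes of any
  -- congruence separating them.
  have retract (t : L) : (t ⊔ u) ⊓ v = u ∨ (t ⊔ u) ⊓ v = v :=
    huv.eq_or_eq (le_inf le_sup_right huv.le) inf_le_right
  have collapse (e : LatticeCon L) (he : ¬e.r u v) {s t : L} (hst : e.r s t) :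
      (s ⊔ u) ⊓ v = (t ⊔ u) ⊓ v := by
    have key : e.r ((s ⊔ u) ⊓ v) ((t ⊔ u) ⊓ v) := e.inf (e.sup hst (e.refl u)) (e.refl v)
    rcases retract s with hs | hs <;> rcases retract t with ht | ht <;> rw [hs, ht] at key ⊢
    · exact absurd key he
    · exact absurd (e.symm key) he
  have const {s t : L} (hst : Relation.EqvGen (fun x y => c.r x y ∨ d.r x y) s t) :
      (s ⊔ u) ⊓ v = (t ⊔ u) ⊓ v := by
    induction hst with
    | rel s t h => exact h.elim (collapse c hn.1) (collapse d hn.2)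
    | refl => rfl
    | symm _ _ _ ih => exact ih.symm
    | trans _ _ _ _ _ ih₁ ih₂ => exact ih₁.trans ih₂
  have := const h
  rw [sup_idem, sup_eq_left.2 huv.le, inf_eq_left.2 huv.le, inf_idem] at this
  exact huv.ne this

/-- A lattice and its order dual have the same congruences. -/
def dualIso : LatticeCon L ≃o LatticeCon Lᵒᵈ where
  toFun c :=
    { r := fun x y => c.r (OrderDual.ofDual x) (OrderDual.ofDual y)
      iseqv := ⟨fun _ => c.refl _, fun h => c.symm h, fun h₁ h₂ => c.trans h₁ h₂⟩
      inf := fun h₁ h₂ => c.sup h₁ h₂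
      sup := fun h₁ h₂ => c.inf h₁ h₂ }
  invFun c :=
    { r := fun x y => c.r (OrderDual.toDual x) (OrderDual.toDual y)
      iseqv := ⟨fun _ => c.refl _, fun h => c.symm h, fun h₁ h₂ => c.trans h₁ h₂⟩
      inf := fun h₁ h₂ => c.sup h₁ h₂
      sup := fun h₁ h₂ => c.inf h₁ h₂ }
  left_inv _ := rfl
  right_inv _ := rfl
  map_rel_iff' := Iff.rfl

/-! ### Colors of intervals. -/

section Color

variable [Lattice D] (e : D ≃o LatticeCon L)

/-- The element of `D` corresponding to the congruence generated by a pair. -/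
def color (x y : L) : D := e.symm (principal x y)

lemma color_le_iff {x y : L} {d : D} : color e x y ≤ d ↔ (e d).r x y := by
  rw [color, OrderIso.symm_apply_le, principal_le_iff]

lemma rel_color (x y : L) : (e (color e x y)).r x y := (color_le_iff e).1 le_rfl

lemma rel_of_rel_of_le {d d' : D} (h : d ≤ d') {x y : L} (hxy : (e d).r x y) : (e d').r x y :=
  (color_le_iff e).1 (((color_le_iff e).2 hxy).trans h)

lemma color_mono {x y u v : L} (hxu : x ≤ u) (huv : u ≤ v) (hvy : v ≤ y) :
    color e u v ≤ color e x y :=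
  (color_le_iff e).2 (rel_of_mem_interval _ (rel_color e x y) hxu huv hvy)

lemma color_le_sup (x y z : L) : color e x z ≤ color e x y ⊔ color e y z :=
  (color_le_iff e).2 ((e _).trans (rel_of_rel_of_le e le_sup_left (rel_color e x y))
    (rel_of_rel_of_le e le_sup_right (rel_color e y z)))

lemma color_sup_le (x y t : L) : color e (x ⊔ t) (y ⊔ t) ≤ color e x y :=
  (color_le_iff e).2 ((e _).sup (rel_color e x y) ((e _).refl t))

lemma color_inf_le (x y t : L) : color e (x ⊓ t) (y ⊓ t) ≤ color e x y :=
  (color_le_iff e).2 ((e _).inf (rel_color e x y) ((e _).refl t))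

/-- Perspective intervals have the same color. -/
lemma color_sup_eq_color_inf (u y : L) : color e u (u ⊔ y) = color e (u ⊓ y) y := by
  apply le_antisymm
  · have := color_sup_le e (u ⊓ y) y u
    rwa [sup_eq_right.2 inf_le_left, sup_comm y u] at this
  · have := color_inf_le e u (u ⊔ y) y
    rwa [inf_eq_right.2 (le_sup_right : y ≤ u ⊔ y)] at this

lemma color_inf_sup (x y : L) : color e (x ⊓ y) (x ⊔ y) = color e x y :=
  eq_of_forall_ge_iff fun d => by rw [color_le_iff, color_le_iff, r_inf_sup_iff]

lemma color_dual (x y : L) :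
    color (e.trans dualIso) (OrderDual.toDual x) (OrderDual.toDual y) = color e x y :=
  eq_of_forall_ge_iff fun d => by rw [color_le_iff, color_le_iff]; rfl

/-- The colors of the intervals with a given bottom. -/
def colorsAbove (u : L) : Set D := {a | ∃ y, u ≤ y ∧ color e u y = a}

/-- The colors of the intervals with a given top. -/
def colorsBelow (v : L) : Set D := {a | ∃ y, y ≤ v ∧ color e y v = a}

lemma colorsAbove_dual (v : L) :
    colorsAbove (e.trans dualIso) (OrderDual.toDual v) = colorsBelow e v := by
  have comm (x y : L) : color e x y = color e y x := by
    rw [← color_inf_sup, inf_comm, sup_comm, color_inf_sup]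
  ext a
  constructor
  · rintro ⟨y, hy, rfl⟩
    exact ⟨OrderDual.ofDual y, hy, (comm _ _).trans (color_dual e v (OrderDual.ofDual y)).symm⟩
  · rintro ⟨y, hy, rfl⟩
    exact ⟨OrderDual.toDual y, hy, by rw [color_dual, comm]⟩

variable [OrderBot D]

lemma color_self (x : L) : color e x x = ⊥ := le_bot_iff.1 ((color_le_iff e).2 ((e _).refl x))

lemma supPrime_color {u v : L} (huv : u ⋖ v) : SupPrime (color e u v) := by
  refine ⟨fun h => ?_, fun b c h => ?_⟩
  · have h := (color_le_iff e).1 (isMin_iff_eq_bot.1 h).le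
    let diag : LatticeCon L :=
      { r := Eq
        iseqv := eq_equivalence
        inf := by rintro _ _ _ _ rfl rfl; rfl
        sup := by rintro _ _ _ _ rfl rfl; rfl }
    have hle : e ⊥ ≤ diag := by
      rw [← OrderIso.le_symm_apply]
      exact bot_le
    exact huv.ne (hle h)
  · simp only [color_le_iff]
    -- Only that `join` is an upper bound is needed.
    have hle : e (b ⊔ c) ≤ join (e b) (e c) := by
      rw [← OrderIso.le_symm_apply, sup_le_iff, OrderIso.le_symm_apply, OrderIso.le_symm_apply]
      exact ⟨le_join_left _ _, le_join_right _ _⟩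
    exact rel_or_rel_of_join huv (hle ((color_le_iff e).1 h))

variable [Finite L]

/-- Splitting an interval bounds its color by the join of the colors of the pieces; a join-prime
lies below one of them. -/
lemma exists_covBy_le_color {b : D} (hb : SupPrime b) {x y : L} (hxy : x ≤ y)
    (h : b ≤ color e x y) : ∃ u v, x ≤ u ∧ u ⋖ v ∧ v ≤ y ∧ b ≤ color e u v := by
  induction y using WellFoundedLT.induction with
  | ind y ih =>
    rcases hxy.eq_or_lt with rfl | hlt
    · rw [color_self] at h
      exact absurd (le_bot_iff.1 h) hb.ne_bot
    · obtain ⟨m, hm, hmy⟩ := exists_le_covBy_of_lt hlt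
      rcases hb.2 (h.trans (color_le_sup e x m y)) with h' | h'
      · obtain ⟨u, v, h₁, h₂, h₃, h₄⟩ := ih m hmy.lt hm h'
        exact ⟨u, v, h₁, h₂, h₃.trans hmy.le, h₄⟩
      · exact ⟨m, y, hm, hmy, le_rfl, h'⟩

/-- `a` is the finite join of the colors of the pairs that `e a` identifies, so by irreducibility it
is one of these colors. -/
lemma exists_covBy_color_eq {a : D} (ha : SupPrime a) : ∃ u v, u ⋖ v ∧ color e u v = a := by
  classical
  have := Fintype.ofFinite L
  let s : Finset (L × L) := {p | (e a).r p.1 p.2}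
  have hs : s.sup (fun p => color e p.1 p.2) = a := by
    apply le_antisymm
    · refine Finset.sup_le fun p hp => (color_le_iff e).2 ?_
      simpa [s] using hp
    · rw [← e.le_iff_le]
      intro x y h
      rw [← color_le_iff]
      exact Finset.le_sup (f := fun p : L × L => color e p.1 p.2) (b := (x, y)) (by simpa [s] using h)
  obtain ⟨⟨x, y⟩, -, hp⟩ := ha.supIrred.finset_sup_eq hs
  rw [← color_inf_sup] at hp
  obtain ⟨u, v, h₁, h₂, h₃, h₄⟩ := exists_covBy_le_color e ha inf_le_sup hp.ge
  exact ⟨u, v, h₂, le_antisymm ((color_mono e h₁ h₂.le h₃).trans hp.le) h₄⟩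

/-- Were the color strictly below `a`, some cover in the interval would have a join-prime color
between `b` and `a`, hence equal to `b`. -/
lemma color_eq_of_no_covBy {a b : D} (hb : SupPrime b)
    (hab : ∀ c, SupPrime c → b ≤ c → c < a → c = b) {x y : L} (hxy : x ≤ y)
    (hle : color e x y ≤ a) (hbc : b ≤ color e x y)
    (hfree : ∀ u v, u ⋖ v → x ≤ u → v ≤ y → color e u v ≠ b) : color e x y = a := by
  by_contra hne
  obtain ⟨u, v, h₁, h₂, h₃, h₄⟩ := exists_covBy_le_color e hb hxy hbc
  exact hfree u v h₂ h₁ h₃ (hab _ (supPrime_color e h₂) h₄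
    ((color_mono e h₁ h₂.le h₃).trans_lt (hle.lt_of_ne hne)))

/-! ### Common endpoints. -/

/-- If `a` covers `b` among the join-prime elements, then both are colors of intervals with a common
endpoint. -/
theorem exists_common_endpoint {a b : D} (ha : SupPrime a) (hb : SupPrime b) (hlt : b < a)
    (hab : ∀ c, SupPrime c → b ≤ c → c < a → c = b) :
    (∃ u, a ∈ colorsAbove e u ∧ b ∈ colorsAbove e u) ∨
      ∃ u, a ∈ colorsBelow e u ∧ b ∈ colorsBelow e u := by
  by_contra! hn
  obtain ⟨hup, hdown⟩ := hn
  -- Without a common endpoint, `r` is a congruence. It identifies a cover of color `a` but none of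
  -- color `b`, which contradicts `b < a`.
  let r : L → L → Prop := fun x y => color e x y ≤ a ∧
    ∀ u v, u ⋖ v → x ⊓ y ≤ u → v ≤ x ⊔ y → color e u v ≠ b
  have r_iff {x y : L} (h : x ≤ y) : r x y ↔ color e x y ≤ a ∧
      ∀ u v, u ⋖ v → x ≤ u → v ≤ y → color e u v ≠ b := by
    simp only [r, inf_eq_left.2 h, sup_eq_right.2 h]
  have sup_case {u v y : L} (huv : u ≤ v) (hv : v ≤ u ⊔ y) (hcol : color e u v = b)
      (hle : color e (u ⊓ y) y ≤ a)
      (hfree : ∀ u' v', u' ⋖ v' → u ⊓ y ≤ u' → v' ≤ y → color e u' v' ≠ b) : False := by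
    have hbc : b ≤ color e (u ⊓ y) y := by
      rw [← hcol, ← color_sup_eq_color_inf]
      exact color_mono e le_rfl huv hv
    have := color_eq_of_no_covBy e hb hab inf_le_right hle hbc hfree
    rw [← color_sup_eq_color_inf] at this
    exact hup u ⟨_, le_sup_left, this⟩ ⟨v, huv, hcol⟩
  have inf_case {u v x : L} (huv : u ≤ v) (hu : x ⊓ v ≤ u) (hcol : color e u v = b)
      (hle : color e x (x ⊔ v) ≤ a)
      (hfree : ∀ u' v', u' ⋖ v' → x ≤ u' → v' ≤ x ⊔ v → color e u' v' ≠ b) : False := by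
    have hbc : b ≤ color e x (x ⊔ v) := by
      rw [← hcol, color_sup_eq_color_inf]
      exact color_mono e hu huv le_rfl
    have := color_eq_of_no_covBy e hb hab le_sup_left hle hbc hfree
    rw [color_sup_eq_color_inf] at this
    exact hdown v ⟨_, inf_le_right, this⟩ ⟨u, huv, hcol⟩
  have : Std.Refl r := ⟨fun x => (r_iff le_rfl).2 ⟨by rw [color_self]; exact bot_le,
    fun u v huv h₁ h₂ => absurd (huv.lt.trans_le (h₂.trans h₁)) (lt_irrefl _)⟩⟩
  let c : LatticeCon L := mk' r
    (fun x y => by rw [r_iff inf_le_sup, color_inf_sup])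
    (fun x y z hxy hyz h₁ h₂ => by
      rw [r_iff hxy] at h₁
      rw [r_iff hyz] at h₂
      rw [r_iff (hxy.trans hyz)]
      refine ⟨(color_le_sup e x y z).trans (sup_le h₁.1 h₂.1), fun u v huv hxu hvz hcol => ?_⟩
      -- Either the interval from u ⊓ y to y, inside [x, y], violates `sup_case`, or [u, v]
      -- transposes up to an interval of color `b` inside [y, z].
      by_cases hv : v ≤ u ⊔ y
      · exact sup_case huv.le hv hcol ((color_mono e (le_inf hxu hxy) inf_le_right le_rfl).trans h₁.1)
          fun u' v' huv' hu' hv' => h₁.2 u' v' huv' ((le_inf hxu hxy).trans hu') hv'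
      · have hinf : (u ⊔ y) ⊓ v = u := (huv.eq_or_eq (le_inf le_sup_left huv.le)
          inf_le_right).resolve_right fun h => hv (inf_eq_right.1 h)
        have heq : color e (u ⊔ y) (u ⊔ y ⊔ v) = b := by rw [color_sup_eq_color_inf, hinf, hcol]
        have htop : u ⊔ y ⊔ v ≤ z := sup_le (sup_le (huv.le.trans hvz) hyz) hvz
        obtain ⟨u', v', g₁, g₂, g₃, g₄⟩ := exists_covBy_le_color e hb le_sup_left heq.ge
        exact h₂.2 u' v' g₂ (le_sup_right.trans g₁) (g₃.trans htop)
          (((color_mono e g₁ g₂.le g₃).trans heq.le).antisymm g₄))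
    (fun x y t hxy h => by
      rw [r_iff hxy] at h
      rw [r_iff (inf_le_inf_right t hxy), r_iff (sup_le_sup_right hxy t)]
      refine ⟨⟨(color_inf_le e x y t).trans h.1, fun u v huv hu hv hcol => ?_⟩,
        ⟨(color_sup_le e x y t).trans h.1, fun u v huv hu hv hcol => ?_⟩⟩
      · have hvy : x ⊔ v ≤ y := sup_le hxy (hv.trans inf_le_left)
        exact inf_case huv.le ((inf_le_inf_left x (hv.trans inf_le_right)).trans hu) hcol
          ((color_mono e le_rfl le_sup_left hvy).trans h.1)
          fun u' v' huv' hu' hv' => h.2 u' v' huv' hu' (hv'.trans hvy)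
      · have hxu : x ≤ u ⊓ y := le_inf (le_sup_left.trans hu) hxy
        exact sup_case huv.le
          (hv.trans (sup_le le_sup_right ((le_sup_right.trans hu).trans le_sup_left))) hcol
          ((color_mono e hxu inf_le_right le_rfl).trans h.1)
          fun u' v' huv' hu' hv' => h.2 u' v' huv' (hxu.trans hu') hv')
  obtain ⟨x, y, hxy, hcol⟩ := exists_covBy_color_eq e ha
  obtain ⟨u, v, huv, hcol'⟩ := exists_covBy_color_eq e hb
  have hr : r x y := (r_iff hxy.le).2 ⟨hcol.le, fun u' v' huv' hu' hv' hb' => by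
    have hu : u' = x := (hxy.eq_or_eq hu' (huv'.le.trans hv')).resolve_right
      fun h => huv'.lt.not_ge (h ▸ hv')
    have hv : v' = y := (hxy.eq_or_eq (hu'.trans huv'.le) hv').resolve_left
      fun h => huv'.lt.not_ge (h ▸ hu')
    rw [hu, hv, hcol] at hb'
    exact hlt.ne' hb'⟩
  have hc : a ≤ e.symm c := by
    rw [← hcol, color_le_iff, OrderIso.apply_symm_apply]
    exact hr
  have hruv : r u v := by
    have := (color_le_iff e).1 (hcol'.le.trans (hlt.le.trans hc))
    rwa [OrderIso.apply_symm_apply] at this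
  exact ((r_iff huv.le).1 hruv).2 u v huv le_rfl le_rfl hcol'

/-! ### Counting colors at a point. -/

/-- Pairwise incomparable join-prime colors of intervals with a common bottom generate a Boolean
join-semilattice. -/
theorem two_pow_card_le_of_subset_colorsAbove {ι : Type*} {f : ι → D} (hf : ∀ i, SupPrime (f i))
    (hanti : ∀ i j, f i ≤ f j → i = j) (u : L) (s : Finset ι)
    (hs : ∀ i ∈ s, f i ∈ colorsAbove e u) : 2 ^ s.card ≤ Nat.card L := by
  classical
  have := Fintype.ofFinite L
  have key (t : Finset ι) (ht : t ⊆ s) :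
      ∃ z, u ≤ z ∧ (∀ i ∈ t, f i ≤ color e u z) ∧ color e u z ≤ t.sup f := by
    induction t using Finset.induction_on with
    | empty => exact ⟨u, le_rfl, by simp, by rw [color_self]; exact bot_le⟩
    | insert i t _ ih =>
      obtain ⟨z, huz, hz₁, hz₂⟩ := ih ((Finset.subset_insert _ _).trans ht)
      obtain ⟨y, huy, hy⟩ := hs i (ht (Finset.mem_insert_self _ _))
      refine ⟨y ⊔ z, huy.trans le_sup_left, fun j hj => ?_, ?_⟩
      · rcases Finset.mem_insert.1 hj with rfl | hj
        · exact hy.ge.trans (color_mono e le_rfl huy le_sup_left)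
        · exact (hz₁ j hj).trans (color_mono e le_rfl huz le_sup_right)
      · rw [Finset.sup_insert, ← hy]
        refine le_trans ((color_le_iff e).2 ?_) (sup_le_sup_left hz₂ _)
        have := (e (color e u y ⊔ color e u z)).sup
          (rel_of_rel_of_le e le_sup_left (rel_color e u y))
          (rel_of_rel_of_le e le_sup_right (rel_color e u z))
        rwa [sup_idem] at this
  have : Nonempty L := ⟨u⟩
  choose! F hF using key
  have hinj : Set.InjOn F (s.powerset : Set (Finset ι)) := by
    -- Primality and incomparability let the color of [u, F t] determine t.
    have recover (t : Finset ι) (ht : t ⊆ s) (i : ι) : i ∈ t ↔ f i ≤ color e u (F t) := by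
      refine ⟨(hF t ht).2.1 i, fun h => ?_⟩
      obtain ⟨j, hj, hij⟩ := (hf i).le_finset_sup.1 (h.trans (hF t ht).2.2)
      exact hanti i j hij ▸ hj
    intro t ht t' ht' h
    rw [Finset.mem_coe, Finset.mem_powerset] at ht ht'
    ext i
    rw [recover t ht, recover t' ht', h]
  rw [← Finset.card_powerset, Nat.card_eq_fintype_card]
  exact Finset.card_le_card_of_injOn F (fun _ _ => Finset.mem_univ _) hinj

theorem card_le_log_of_subset_colorsAbove {ι : Type*} {f : ι → D} (hf : ∀ i, SupPrime (f i))
    (hanti : ∀ i j, f i ≤ f j → i = j) (u : L) (s : Finset ι)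
    (hs : ∀ i ∈ s, f i ∈ colorsAbove e u) : s.card ≤ Nat.log 2 (Nat.card L) :=
  have h := two_pow_card_le_of_subset_colorsAbove e hf hanti u s hs
  Nat.le_log_of_pow_le one_lt_two h

end Color

/-- If every element of an antichain of join-primes covers every element of another one among the
join-primes, then the lattice is large. -/
theorem sq_card_le [Lattice D] [OrderBot D] [Finite L] (e : D ≃o LatticeCon L) {ι : Type*}
    [Fintype ι] {f g : ι → D} (hf : ∀ i, SupPrime (f i))
    (hg : ∀ i, SupPrime (g i)) (hfanti : ∀ i j, f i ≤ f j → i = j)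
    (hganti : ∀ i j, g i ≤ g j → i = j) (hlt : ∀ i j, g j < f i)
    (hcov : ∀ i j c, SupPrime c → g j ≤ c → c < f i → c = g j) :
    Fintype.card ι ^ 2 ≤ 2 * (Nat.card L * Nat.log 2 (Nat.card L) ^ 2) := by
  classical
  have := Fintype.ofFinite L
  let k := Nat.log 2 (Nat.card L)
  let pairsAbove (u : L) : Finset (ι × ι) :=
    ({i | f i ∈ colorsAbove e u} : Finset ι) ×ˢ ({i | g i ∈ colorsAbove e u} : Finset ι)
  let pairsBelow (u : L) : Finset (ι × ι) :=
    ({i | f i ∈ colorsBelow e u} : Finset ι) ×ˢ ({i | g i ∈ colorsBelow e u} : Finset ι)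
  have cardAbove (u : L) : (pairsAbove u).card ≤ k ^ 2 := by
    rw [Finset.card_product, sq]
    exact Nat.mul_le_mul
      (card_le_log_of_subset_colorsAbove e hf hfanti u _ fun i hi => (Finset.mem_filter.1 hi).2)
      (card_le_log_of_subset_colorsAbove e hg hganti u _ fun i hi => (Finset.mem_filter.1 hi).2)
  have cardBelow (u : L) : (pairsBelow u).card ≤ k ^ 2 := by
    have hk : k = Nat.log 2 (Nat.card Lᵒᵈ) := rfl
    rw [Finset.card_product, sq, hk]
    exact Nat.mul_le_mul
      (card_le_log_of_subset_colorsAbove (e.trans dualIso) hf hfanti (OrderDual.toDual u) _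
        fun i hi => by rw [colorsAbove_dual]; exact (Finset.mem_filter.1 hi).2)
      (card_le_log_of_subset_colorsAbove (e.trans dualIso) hg hganti (OrderDual.toDual u) _
        fun i hi => by rw [colorsAbove_dual]; exact (Finset.mem_filter.1 hi).2)
  have cover : (Finset.univ : Finset (ι × ι)) ⊆
      Finset.univ.biUnion pairsAbove ∪ Finset.univ.biUnion pairsBelow := by
    rintro ⟨i, j⟩ -
    have := exists_common_endpoint e (hf i) (hg j) (hlt i j) (hcov i j)
    simpa [pairsAbove, pairsBelow] using this
  calc Fintype.card ι ^ 2 = (Finset.univ : Finset (ι × ι)).card := by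
        rw [Finset.card_univ, Fintype.card_prod, sq]
    _ ≤ _ := Finset.card_le_card cover
    _ ≤ _ := Finset.card_union_le _ _
    _ ≤ Nat.card L * k ^ 2 + Nat.card L * k ^ 2 := by
        rw [Nat.card_eq_fintype_card, ← Finset.card_univ]
        exact Nat.add_le_add (Finset.card_biUnion_le_card_mul _ _ _ fun u _ => cardAbove u)
          (Finset.card_biUnion_le_card_mul _ _ _ fun u _ => cardBelow u)
    _ = _ := by ring

end LatticeCon

/-! ### The complete bipartite order. -/

/-- Two copies of `ι`, each element `inl j` lying below each element `inr i`. -/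
def CompleteBipartiteOrder (ι : Type*) : Type _ := ι ⊕ ι

namespace CompleteBipartiteOrder

variable {ι : Type*}

instance : PartialOrder (CompleteBipartiteOrder ι) where
  le x y := x = y ∨ (Sum.isLeft x ∧ Sum.isRight y)
  le_refl _ := .inl rfl
  le_trans := by
    rintro x y z (rfl | ⟨h₁, h₂⟩) (rfl | ⟨h₃, h₄⟩)
    exacts [.inl rfl, .inr ⟨h₃, h₄⟩, .inr ⟨h₁, h₂⟩, .inr ⟨h₁, h₄⟩]
  le_antisymm := by
    rintro x y (h | ⟨h₁, h₂⟩) (h' | ⟨h₃, h₄⟩)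
    exacts [h, h, h'.symm, by rcases x with x | x <;> simp_all]

/-- The minimal elements. -/
def lower (i : ι) : CompleteBipartiteOrder ι := Sum.inl i

/-- The maximal elements. -/
def upper (i : ι) : CompleteBipartiteOrder ι := Sum.inr i

lemma lower_le_lower {i j : ι} (h : lower i ≤ lower j) : i = j := by
  rcases h with h | ⟨-, h⟩
  · exact Sum.inl.inj h
  · simp [lower] at h

lemma upper_le_upper {i j : ι} (h : upper i ≤ upper j) : i = j := by
  rcases h with h | ⟨h, -⟩
  · exact Sum.inr.inj h
  · simp [upper] at h

lemma lower_lt_upper (i j : ι) : lower j < upper i :=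
  lt_of_le_of_ne (.inr ⟨rfl, rfl⟩) Sum.inl_ne_inr

lemma eq_lower_of_le_of_lt {i j : ι} {x : CompleteBipartiteOrder ι} (h₁ : lower j ≤ x)
    (h₂ : x < upper i) : x = lower j := by
  rcases x with k | k
  · exact congrArg lower (lower_le_lower h₁).symm
  · exact absurd (upper_le_upper h₂.le) fun h => h₂.ne (congrArg upper h)

instance [Finite ι] : Finite (CompleteBipartiteOrder ι) := inferInstanceAs (Finite (ι ⊕ ι))

lemma numJoinIrred_lowerSet (n : ℕ) :
    numJoinIrred (LowerSet (CompleteBipartiteOrder (Fin n))) = 2 * n := by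
  rw [numJoinIrred, ← Nat.card_congr OrderIso.supIrredLowerSet.toEquiv]
  change Nat.card (Fin n ⊕ Fin n) = _
  rw [Nat.card_sum, Nat.card_fin, two_mul]

/-- A lattice whose congruences form the lattice of lower sets of the complete bipartite order of
height two on `n + n` elements is large. -/
theorem sq_le_of_orderIso {n : ℕ} {L : Type*} [Lattice L] [Finite L]
    (e : LowerSet (CompleteBipartiteOrder (Fin n)) ≃o LatticeCon L) :
    n ^ 2 ≤ 2 * (Nat.card L * Nat.log 2 (Nat.card L) ^ 2) := by
  have prime (x : CompleteBipartiteOrder (Fin n)) : SupPrime (LowerSet.Iic x) :=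
    supPrime_iff_supIrred.2 (LowerSet.supIrred_Iic x)
  have Iic_iff {x y : CompleteBipartiteOrder (Fin n)} :
      LowerSet.Iic x ≤ LowerSet.Iic y ↔ x ≤ y := LowerSet.Iic_le.trans LowerSet.mem_Iic_iff
  have Iic_lt_iff {x y : CompleteBipartiteOrder (Fin n)} :
      LowerSet.Iic x < LowerSet.Iic y ↔ x < y := lt_iff_lt_of_le_iff_le' Iic_iff Iic_iff
  have := LatticeCon.sq_card_le e (f := fun i => LowerSet.Iic (upper i))
    (g := fun i => LowerSet.Iic (lower i)) (fun i => prime _) (fun i => prime _)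
    (fun i j h => upper_le_upper (Iic_iff.1 h)) (fun i j h => lower_le_lower (Iic_iff.1 h))
    (fun i j => Iic_lt_iff.2 (lower_lt_upper i j))
    (fun i j c hc h₁ h₂ => by
      obtain ⟨x, rfl⟩ := LowerSet.supIrred_iff_of_finite.1 hc.supIrred
      rw [eq_lower_of_le_of_lt (Iic_iff.1 h₁) (Iic_lt_iff.1 h₂)])
  rwa [Fintype.card_fin] at this

end CompleteBipartiteOrder

/-! ### Asymptotics. -/

lemma Nat.log_two_sq_le_rpow {δ : ℝ} (hδ : 0 < δ) (m : ℕ) :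
    (Nat.log 2 m : ℝ) ^ 2 ≤ (δ / 2 * Real.log 2)⁻¹ ^ 2 * (m : ℝ) ^ δ := by
  have hlog2 : 0 < Real.log 2 := Real.log_pos one_lt_two
  have h : (Nat.log 2 m : ℝ) ≤ (δ / 2 * Real.log 2)⁻¹ * (m : ℝ) ^ (δ / 2) := by
    calc (Nat.log 2 m : ℝ) ≤ Real.logb 2 m := by exact_mod_cast Real.natLog_le_logb m 2
      _ = Real.log m / Real.log 2 := rfl
      _ ≤ ((m : ℝ) ^ (δ / 2) / (δ / 2)) / Real.log 2 := by
          gcongr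
          exact Real.log_le_rpow_div m.cast_nonneg (half_pos hδ)
      _ = _ := by field_simp
  calc (Nat.log 2 m : ℝ) ^ 2 ≤ ((δ / 2 * Real.log 2)⁻¹ * (m : ℝ) ^ (δ / 2)) ^ 2 := by gcongr
    _ = _ := by
      rw [mul_pow, ← Real.rpow_natCast ((m : ℝ) ^ (δ / 2)), ← Real.rpow_mul m.cast_nonneg]
      norm_num

theorem theoremT (α : ℝ) (h : RepresentableWithSize α) : 2 ≤ α := by
  by_contra! hα
  obtain ⟨C, N, h⟩ := h
  -- With this choice 2 - α(1 + δ) = (2 - α)(1 - α/4), positive for α < 2.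
  let δ : ℝ := (2 - α) / 4
  have hδ : 0 < δ := by simp only [δ]; linarith
  have hexp : 0 < 2 - α * (1 + δ) := by simp only [δ]; nlinarith
  -- The factor 2 ^ α comes from the 2n join-irreducibles; |C| keeps the base of the real power
  -- nonnegative.
  let K : ℝ := 2 * ((δ / 2 * Real.log 2)⁻¹ ^ 2 * (|C| * 2 ^ α) ^ (1 + δ))
  have bound (n : ℕ) (hn : N ≤ n) (hpos : 0 < n) : (n : ℝ) ^ (2 - α * (1 + δ)) ≤ K := by
    have hn0 : (0 : ℝ) < n := by exact_mod_cast hpos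
    obtain ⟨L, _, _, ⟨e⟩, hcard⟩ := h (LowerSet (CompleteBipartiteOrder (Fin n)))
      (by rw [CompleteBipartiteOrder.numJoinIrred_lowerSet]; lia)
    rw [CompleteBipartiteOrder.numJoinIrred_lowerSet] at hcard
    have hsq : ((n : ℝ)) ^ 2 ≤ 2 * (Nat.card L * (Nat.log 2 (Nat.card L) : ℝ) ^ 2) := by
      exact_mod_cast CompleteBipartiteOrder.sq_le_of_orderIso e
    have hcard' : (Nat.card L : ℝ) ≤ |C| * 2 ^ α * (n : ℝ) ^ α := by
      refine hcard.trans ?_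
      push_cast
      rw [Real.mul_rpow zero_le_two hn0.le, ← mul_assoc]
      gcongr
      exact le_abs_self C
    have hm : (0 : ℝ) ≤ Nat.card L := Nat.cast_nonneg _
    have : (n : ℝ) ^ 2 ≤ K * (n : ℝ) ^ (α * (1 + δ)) := by
      calc (n : ℝ) ^ 2 ≤ 2 * (Nat.card L * (Nat.log 2 (Nat.card L) : ℝ) ^ 2) := hsq
        _ ≤ 2 * (Nat.card L * ((δ / 2 * Real.log 2)⁻¹ ^ 2 * (Nat.card L : ℝ) ^ δ)) := by
            gcongr
            exact Nat.log_two_sq_le_rpow hδ _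
        _ = 2 * ((δ / 2 * Real.log 2)⁻¹ ^ 2 * (Nat.card L : ℝ) ^ (1 + δ)) := by
            rw [Real.rpow_add' hm (by positivity), Real.rpow_one]
            ring
        _ ≤ 2 * ((δ / 2 * Real.log 2)⁻¹ ^ 2 * (|C| * 2 ^ α * (n : ℝ) ^ α) ^ (1 + δ)) := by
            gcongr
        _ = K * (n : ℝ) ^ (α * (1 + δ)) := by
            rw [Real.mul_rpow (by positivity) (by positivity), ← Real.rpow_mul hn0.le]
            ring
    rw [Real.rpow_sub hn0, Real.rpow_two]
    exact (div_le_iff₀ (Real.rpow_pos_of_pos hn0 _)).2 this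
  have htend := (tendsto_rpow_atTop hexp).comp tendsto_natCast_atTop_atTop
  obtain ⟨n, hn, hNn, hpos⟩ := ((htend.eventually_gt_atTop K).and
    ((Filter.eventually_ge_atTop N).and (Filter.eventually_gt_atTop 0))).exists
  exact absurd (bound n hNn hpos) (not_le.2 hn)
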